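/- **Corollary 1.3.** Call *fat rhombus* the rhombus with side length $1$ and angles $72^\circ,108^\circ$, and *thin rhombus* the rhombus with side length $1$ and angles $36^\circ,144^\circ$. Decorate their edges with arrows as follows. In each rhombus fix a corner $p$, of angle $72^\circ$ in the fat and of angle $144^\circ$ in the thin rhombus, and let $q$ be the corner opposite to $p$. The two edges at $p$ carry dashed arrows pointing towards $p$. The two edges at $q$ carry solid arrows, pointing away from $q$ in the fat rhombus and towards $q$ in the thin rhombus. A *Penrose tiling* is a set of isometric copies of these two decorated tiles that covers $\mathbb{R}^2$ and in which any two distinct tiles are disjoint, or meet exactly in a common corner, or meet exactly in a common edge on which their arrows have the same type and the same direction. A *Penrose framework* $(G,\rho)$ is the 1-skeleton of a Penrose tiling: $G$ is a graph and $\rho$ is a bijection from its vertex set $V$ to the set of corners of tiles such that $uv$ is an edge of $G$ if and only if $\rho(u)$ and $\rho(v)$ are the endpoints of an edge of a tile. Let $\mathcal{C}_5=\langle\omega:\omega^5=1\rangle$ act faithfully on $G$ by graph automorphisms, in such a way that every vertex fixed by some $\gamma\neq 1$ is fixed by all of $\mathcal{C}_5$, and that no two vertices fixed by $\mathcal{C}_5$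 are adjacent. A map $\rho':V\to\mathbb{R}^2$ is called *$\mathcal{C}_5$-symmetric* with centre $c\in\mathbb{R}^2$ if $\rho'(\omega^j v)$ is the image of $\rho'(v)$ under the clockwise rotation about $c$ by $2\pi j/5$, for all $v\in V$ and all $j$. Let $(G,\rho)$ be a Penrose framework with such an action for which $\rho$ is $\mathcal{C}_5$-symmetric with centre $c$. Then $(G,\rho)$ has a non-trivial flex that preserves this symmetry. That is, there are $\delta>0$ and a path $t\mapsto\rho_t$, $t\in[0,\delta)$, of maps $\rho_t:V\to\mathbb{R}^2$ such that 1. $\rho_0=\rho$, and $t\mapsto\rho_t(v)$ is continuous on $[0,\delta)$ for every $v\in V$; 2. $\rho_t(u)\neq\rho_t(v)$ and $\|\rho_t(u)-\rho_t(v)\|=\|\rho(u)-\rho(v)\|$ for every edge $uv$ of $G$ and every $t\in[0,\delta)$; 3. for some $t\in[0,\delta)$ there is no isometry $M$ of $\mathbb{R}^2$ with $M\rho_t(v)=\rho(v)$ for all $v\in V$; 4. every $\rho_t$, $t\in[0,\delta)$, is $\mathcal{C}_5$-symmetric with centre $c$, for the same action. -/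

import Mathlib

/-!
Planar frameworks, their flexes, rotational symmetry, and frameworks of Penrose rhombus tilings.
The Euclidean plane `ℝ²` is modelled by `ℂ`, whose distance is the Euclidean distance.
-/

namespace Penrose

/-! ### Frameworks and flexes -/

/-- A realization of the graph `G` in the plane: adjacent vertices are sent to distinct points. -/
def IsRealization {V : Type*} (G : SimpleGraph V) (ρ : V → ℂ) : Prop :=
  ∀ u v : V, G.Adj u v → ρ u ≠ ρ v

/-- `t ↦ ρt t`, for `t ∈ [0, δ)`, is a flex of the framework `(G, ρ)`: a continuous path (for the
product topology on `V → ℂ`) of realizations of `G` that starts at `ρ` and along which all edge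
lengths are those of `ρ`. The values of `ρt` outside `[0, δ)` are irrelevant. -/
structure IsFlex {V : Type*} (G : SimpleGraph V) (ρ : V → ℂ) (δ : ℝ) (ρt : ℝ → V → ℂ) :
    Prop where
  pos : 0 < δ
  continuousOn : ContinuousOn ρt (Set.Ico 0 δ)
  isRealization : ∀ t ∈ Set.Ico 0 δ, IsRealization G (ρt t)
  initial : ρt 0 = ρ
  length : ∀ t ∈ Set.Ico 0 δ, ∀ u v : V, G.Adj u v → dist (ρt t u) (ρt t v) = dist (ρ u) (ρ v)

/-- Two maps to the plane are congruent if they differ by a Euclidean isometry of the plane. -/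
def Congruent {V : Type*} (ρ' ρ : V → ℂ) : Prop :=
  ∃ M : ℂ ≃ᵢ ℂ, ∀ v : V, M (ρ' v) = ρ v

/-- A flex is trivial if every realization in it is congruent to the initial one. -/
def IsTrivialFlex {V : Type*} (ρ : V → ℂ) (δ : ℝ) (ρt : ℝ → V → ℂ) : Prop :=
  ∀ t ∈ Set.Ico 0 δ, Congruent (ρt t) ρ

/-! ### Rotational symmetry. The cyclic group of order `k` is `Multiplicative (ZMod k)`, with
generator `Multiplicative.ofAdd 1`. -/

/-- The action `θ` of the cyclic group of order `k` by automorphisms of `G` makes `G` a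
`C_k`-symmetric graph. -/
structure IsSymmetricGraph {V : Type*} (k : ℕ) (G : SimpleGraph V)
    (θ : Multiplicative (ZMod k) →* (G ≃g G)) : Prop where
  injective : Function.Injective θ
  /-- Every partially invariant vertex is invariant. -/
  invariant : ∀ v : V, (∃ γ, γ ≠ 1 ∧ θ γ v = v) → ∀ γ, θ γ v = v
  /-- The invariant vertices form an independent set. -/
  independent : ∀ u v : V, (∀ γ, θ γ u = u) → (∀ γ, θ γ v = v) → ¬ G.Adj u v

/-- Clockwise rotation of the plane about the point `c` by the angle `φ`. -/
noncomputable def rotateCW (c : ℂ) (φ : ℝ) (z : ℂ) : ℂ :=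
  c + Complex.exp (-(φ : ℂ) * Complex.I) * (z - c)

/-- The map `ρ` is `C_k`-symmetric with centre `c`: the `j`-th power of the generator acts on the
placed vertices as the clockwise rotation about `c` by `2πj/k`. -/
def IsSymmetricRealization {V : Type*} (k : ℕ) {G : SimpleGraph V}
    (θ : Multiplicative (ZMod k) →* (G ≃g G)) (c : ℂ) (ρ : V → ℂ) : Prop :=
  ∀ (j : ℕ) (v : V),
    ρ (θ (Multiplicative.ofAdd (j : ZMod k)) v) = rotateCW c (2 * Real.pi * j / k) (ρ v)

/-! ### Penrose rhombus tilings -/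

/-- The two tile types: the fat rhombus, with angles 72° and 108°, and the thin rhombus, with
angles 36° and 144°. -/
inductive TileKind
  | fat
  | thin

/-- The two types of arrows that decorate the edges of the tiles. -/
inductive ArrowKind
  | dashed
  | solid

/-- A decorated directed edge in the plane. -/
structure Arrow where
  kind : ArrowKind
  source : ℂ
  target : ℂ

/-- A placed decorated tile of side length 1. `apex` is the corner at which the two dashed
edges of the tile meet: a 72° corner of a fat tile, a 144° corner of a thin tile.
`side` is the clockwise first of the two sides issuing from `apex`. Both prototiles
are mirror symmetric together with their arrows, so reflected copies are rotated copies. -/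
structure Tile where
  kind : TileKind
  apex : ℂ
  side : ℂ
  norm_side : ‖side‖ = 1

namespace Tile

/-- The second side issuing from the apex, at angle 72° (fat) or 144° (thin) to the first one. -/
noncomputable def side' (S : Tile) : ℂ :=
  match S.kind with
  | .fat => Complex.exp ((2 * Real.pi / 5 : ℝ) * Complex.I) * S.side
  | .thin => Complex.exp ((4 * Real.pi / 5 : ℝ) * Complex.I) * S.side

/-- The corner opposite to the apex. -/
noncomputable def opposite (S : Tile) : ℂ := S.apex + S.side + S.side'

/-- The four corners of the tile. -/
noncomputable def corners (S : Tile) : Set ℂ :=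
  {S.apex, S.apex + S.side, S.opposite, S.apex + S.side'}

/-- The closed rhombus covered by the tile. -/
noncomputable def region (S : Tile) : Set ℂ :=
  {z | ∃ a ∈ Set.Icc (0 : ℝ) 1, ∃ b ∈ Set.Icc (0 : ℝ) 1,
    z = S.apex + (a : ℂ) * S.side + (b : ℂ) * S.side'}

/-- The four decorated edges of the tile. On both tiles the two dashed arrows point to the
apex. The two solid arrows issue from the corner opposite to the apex on the fat tile and point
to that corner on the thin tile. -/
noncomputable def arrows (S : Tile) : Set Arrow :=
  match S.kind with
  | .fat =>
    {⟨.dashed, S.apex + S.side, S.apex⟩, ⟨.dashed, S.apex + S.side', S.apex⟩,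
      ⟨.solid, S.opposite, S.apex + S.side⟩, ⟨.solid, S.opposite, S.apex + S.side'⟩}
  | .thin =>
    {⟨.dashed, S.apex + S.side, S.apex⟩, ⟨.dashed, S.apex + S.side', S.apex⟩,
      ⟨.solid, S.apex + S.side, S.opposite⟩, ⟨.solid, S.apex + S.side', S.opposite⟩}

end Tile

/-- A Penrose rhombus tiling: the tiles cover the plane, and two distinct tiles are disjoint, or
meet exactly in a common corner, or meet exactly in a common edge on which both tiles carry
the same arrow (same type and same direction). -/
structure IsPenroseTiling (T : Set Tile) : Prop where
  covers : ∀ z : ℂ, ∃ S ∈ T, z ∈ S.region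
  matching : ∀ S ∈ T, ∀ S' ∈ T, S ≠ S' →
    S.region ∩ S'.region = ∅ ∨
    (∃ p ∈ S.corners ∩ S'.corners, S.region ∩ S'.region = {p}) ∨
    (∃ e ∈ S.arrows ∩ S'.arrows, S.region ∩ S'.region = segment ℝ e.source e.target)

/-- `(G, ρ)` is a Penrose framework, i.e. the 1-skeleton of a Penrose rhombus tiling: `ρ` is a
bijection from the vertices of `G` to the corners of the tiles, under which the edges of `G`
correspond to the edges of the tiles. -/
def IsPenroseFramework {V : Type*} (G : SimpleGraph V) (ρ : V → ℂ) : Prop :=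
  ∃ T : Set Tile, IsPenroseTiling T ∧
    Function.Injective ρ ∧
    Set.range ρ = {p | ∃ S ∈ T, p ∈ S.corners} ∧
    ∀ u v : V, G.Adj u v ↔ ∃ S ∈ T, ∃ e ∈ S.arrows,
      (e.source = ρ u ∧ e.target = ρ v) ∨ (e.source = ρ v ∧ e.target = ρ u)

end Penrose

/-!
Let `ζ = exp (2πi/5)`, and let `b` be the apex and `u` a side of some tile. All vertices of the
tiling lie in `b + u ℤ[ζ]`, so each is `b + u ∑ j, k j * ζ ^ j` with an integer vector `k` that is
unique up to multiples of `(1, 1, 1, 1, 1)`. The matching rules single out one such `k` per vertex: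
following the arrows from tile to tile, the level `∑ j, k j` stays in `{0, 1, 2, 3}`
(`Tile.isGood_iff_of_mem_arrows`, `Tile.IsGood.exists_coords`). This reaches every tile, because a
locally finite tiling is connected through edges: the plane minus the countably many corners is
connected (`IsPenroseTiling.forall_of_propagates`). With these coordinates every edge changes
exactly one coordinate, by one.

The rotation changes all levels by one constant modulo `5`, and this constant is `0` because the
class `4` is never met. Hence the centre lies in the lattice, and the coordinates `K v` relative to
the centre are permuted cyclically by the rotation (`exists_centered_coords`).

Now let `F t : ℤ → ℂ` be the positions along a folding line, all of whose steps
`F t (n + 1) - F t n` are unit vectors, the odd ones turned by the angle `t` (`foldCoord`). The path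
`ρt t v = c + u ∑ j, F t (K v j) * ζ ^ j` starts at `ρ`, keeps all edges at unit length and is
symmetric. It is not trivial: at `t = π` the line is folded flat, so that `ρt π` is bounded, whereas
the vertices of a tiling of the plane are not. Since the coordinates are globally defined, no closing
condition around the rhombi has to be checked.
-/

namespace Penrose

/-! ### Integer combinations of fifth roots of unity -/

/-- The primitive fifth root of unity `exp (2πi/5)`. -/
noncomputable def zeta : ℂ := Complex.exp ((2 * Real.pi / 5 : ℝ) * Complex.I)

theorem isPrimitiveRoot_zeta : IsPrimitiveRoot zeta 5 := by
  have h := Complex.isPrimitiveRoot_exp 5 (by norm_num)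
  have e : zeta = Complex.exp (2 * Real.pi * Complex.I / (5 : ℕ)) := by
    unfold zeta
    congr 1
    push_cast
    ring
  rw [e]
  exact h

theorem zeta_pow_five : zeta ^ 5 = 1 := isPrimitiveRoot_zeta.pow_eq_one

theorem zeta_ne_zero : zeta ≠ 0 := Complex.exp_ne_zero _

theorem norm_zeta : ‖zeta‖ = 1 := Complex.norm_exp_ofReal_mul_I _

theorem zeta_sum : 1 + zeta + zeta ^ 2 + zeta ^ 3 + zeta ^ 4 = 0 := by
  have h := isPrimitiveRoot_zeta.geom_sum_eq_zero (by norm_num)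
  simpa [Finset.sum_range_succ] using h

theorem zeta_sq : zeta ^ 2 = Complex.exp ((4 * Real.pi / 5 : ℝ) * Complex.I) := by
  rw [zeta, ← Complex.exp_nat_mul]
  congr 1
  push_cast
  ring

/-- The complex number with coordinates `g 0, …, g 4` along the fifth roots of unity. -/
noncomputable def rootSum (g : Fin 5 → ℂ) : ℂ := ∑ j, g j * zeta ^ (j : ℕ)

theorem rootSum_add (g h : Fin 5 → ℂ) : rootSum (g + h) = rootSum g + rootSum h := by
  simp [rootSum, add_mul, Finset.sum_add_distrib]

theorem rootSum_sub (g h : Fin 5 → ℂ) : rootSum (g - h) = rootSum g - rootSum h := by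
  simp [rootSum, sub_mul, Finset.sum_sub_distrib]

theorem rootSum_single (j : Fin 5) (a : ℂ) : rootSum (Pi.single j a) = a * zeta ^ (j : ℕ) := by
  rw [rootSum, Finset.sum_eq_single j]
  · simp
  · intro i _ hi
    simp [hi]
  · simp

theorem rootSum_shift (g : Fin 5 → ℂ) : zeta * rootSum (fun j => g (j + 1)) = rootSum g := by
  simp only [rootSum, Fin.sum_univ_five]
  have e : ∀ a b c d f : ℂ,
      zeta * (a * zeta ^ ((0 : Fin 5) : ℕ) + b * zeta ^ ((1 : Fin 5) : ℕ)
        + c * zeta ^ ((2 : Fin 5) : ℕ) + d * zeta ^ ((3 : Fin 5) : ℕ)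
        + f * zeta ^ ((4 : Fin 5) : ℕ))
      = f * zeta ^ ((0 : Fin 5) : ℕ) + a * zeta ^ ((1 : Fin 5) : ℕ)
        + b * zeta ^ ((2 : Fin 5) : ℕ) + c * zeta ^ ((3 : Fin 5) : ℕ)
        + d * zeta ^ ((4 : Fin 5) : ℕ) := by
    intro a b c d f
    have h := zeta_pow_five
    simp only [Fin.val_zero, Fin.val_one, Fin.val_two, show ((3 : Fin 5) : ℕ) = 3 from rfl,
      show ((4 : Fin 5) : ℕ) = 4 from rfl]
    linear_combination f * h
  exact e _ _ _ _ _

/-- The integer combination of the fifth roots of unity with coefficients `k`. -/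
noncomputable def intSum (k : Fin 5 → ℤ) : ℂ := rootSum fun j => (k j : ℂ)

theorem intSum_add (k l : Fin 5 → ℤ) : intSum (k + l) = intSum k + intSum l := by
  rw [intSum, intSum, intSum, ← rootSum_add]
  congr 1
  ext j
  simp

theorem intSum_sub (k l : Fin 5 → ℤ) : intSum (k - l) = intSum k - intSum l := by
  rw [intSum, intSum, intSum, ← rootSum_sub]
  congr 1
  ext j
  simp

theorem intSum_single (j : Fin 5) (a : ℤ) : intSum (Pi.single j a) = a * zeta ^ (j : ℕ) := by
  rw [← rootSum_single, intSum]
  congr 1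
  ext i
  by_cases h : i = j
  · subst h
    simp
  · simp [h]

theorem intSum_shift (k : Fin 5 → ℤ) : zeta * intSum (fun j => k (j + 1)) = intSum k :=
  rootSum_shift fun j => (k j : ℂ)

/-- The only integer relations between the fifth roots of unity are the multiples of
`1 + ζ + ζ² + ζ³ + ζ⁴ = 0`, as the fifth cyclotomic polynomial is irreducible. -/
theorem eq_const_of_intSum_eq_zero {k : Fin 5 → ℤ} (h : intSum k = 0) :
    ∃ m : ℤ, ∀ j, k j = m := by
  open Polynomial in
  let p : ℤ[X] := C (k 0 - k 4) + C (k 1 - k 4) * X + C (k 2 - k 4) * X ^ 2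
    + C (k 3 - k 4) * X ^ 3
  have hroot : Polynomial.aeval zeta p = 0 := by
    simp only [intSum, rootSum, Fin.sum_univ_five, Fin.val_zero, Fin.val_one, Fin.val_two,
      show ((3 : Fin 5) : ℕ) = 3 from rfl, show ((4 : Fin 5) : ℕ) = 4 from rfl] at h
    simp only [p, map_add, map_mul, map_pow, Polynomial.aeval_X, Polynomial.aeval_C,
      algebraMap_int_eq, eq_intCast (Int.castRingHom ℂ), Int.cast_sub]
    have hs := zeta_sum
    linear_combination h - (k 4 : ℂ) * hs
  have hdvd : minpoly ℤ zeta ∣ p :=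
    minpoly.isIntegrallyClosed_dvd (isPrimitiveRoot_zeta.isIntegral (by norm_num)) hroot
  rw [← Polynomial.cyclotomic_eq_minpoly isPrimitiveRoot_zeta (by norm_num)] at hdvd
  have hp : p = 0 := by
    refine Polynomial.eq_zero_of_dvd_of_degree_lt hdvd ?_
    rw [Polynomial.degree_cyclotomic]
    have hphi : Nat.totient 5 = 4 := by decide
    rw [hphi]
    have : p.degree ≤ (3 : ℕ) := by
      simp only [p]
      compute_degree!
    exact lt_of_le_of_lt this (by norm_num)
  have c0 := congrArg (Polynomial.coeff · 0) hp
  have c1 := congrArg (Polynomial.coeff · 1) hp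
  have c2 := congrArg (Polynomial.coeff · 2) hp
  have c3 := congrArg (Polynomial.coeff · 3) hp
  simp [p, Polynomial.coeff_X, Polynomial.coeff_C, Polynomial.coeff_X_pow, -eq_intCast, -map_sub]
    at c0 c1 c2 c3
  refine ⟨k 4, fun j => ?_⟩
  fin_cases j <;> simp <;> omega

theorem exists_eq_add_of_intSum_eq {k l : Fin 5 → ℤ} (h : intSum k = intSum l) :
    ∃ m : ℤ, (∑ j, k j = ∑ j, l j + 5 * m) ∧ ∀ j, k j = l j + m := by
  have h0 : intSum (k - l) = 0 := by rw [intSum_sub, h, sub_self]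
  obtain ⟨m, hm⟩ := eq_const_of_intSum_eq_zero h0
  have hm' : ∀ j, k j = l j + m := fun j => by
    have := hm j
    simp only [Pi.sub_apply] at this
    omega
  refine ⟨m, ?_, hm'⟩
  simp only [Fin.sum_univ_five, hm']
  ring

/-- The coefficients of an integer combination of fifth roots of unity are determined by its value
once their sum is confined to fewer than five consecutive integers. -/
theorem eq_of_intSum_eq {k l : Fin 5 → ℤ} (h : intSum k = intSum l)
    (hkl : |∑ j, k j - ∑ j, l j| < 5) : k = l := by
  obtain ⟨m, hs, hm⟩ := exists_eq_add_of_intSum_eq h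
  have h5 := abs_lt.1 hkl
  have : m = 0 := by omega
  subst this
  ext j
  simpa using hm j

/-! ### Levels of vertices and the matching rules -/

/-- `z` is a lattice point of level `n`: in the lattice `b + u ℤ[ζ]` it has coordinates, along the
five fifth roots of unity, that sum to `n`. -/
def HasLevel (b u : ℂ) (n : ℤ) (z : ℂ) : Prop :=
  ∃ k : Fin 5 → ℤ, ∑ j, k j = n ∧ z = b + u * intSum k

/-- `d` is `s` times a fifth root of unity, up to the common factor `u`. In use, `s = ±1`. -/
def HasSign (u : ℂ) (s : ℤ) (d : ℂ) : Prop := ∃ j : Fin 5, d = s * u * zeta ^ (j : ℕ)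

variable {b u : ℂ} {n s : ℤ} {z d : ℂ}

theorem HasSign.exists_step (hd : HasSign u s d) {k : Fin 5 → ℤ} (hz : z = b + u * intSum k) :
    ∃ j : Fin 5, z + d = b + u * intSum (k + Pi.single j s) := by
  obtain ⟨j, rfl⟩ := hd
  refine ⟨j, ?_⟩
  rw [hz, intSum_add, intSum_single]
  ring

theorem HasSign.neg (hd : HasSign u s d) : HasSign u (-s) (-d) := by
  obtain ⟨j, rfl⟩ := hd
  exact ⟨j, by push_cast; ring⟩

theorem hasSign_neg_iff : HasSign u (-s) (-d) ↔ HasSign u s d :=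
  ⟨fun h => by simpa using h.neg, HasSign.neg⟩

theorem HasSign.zeta_mul (hd : HasSign u s d) : HasSign u s (zeta * d) := by
  obtain ⟨j, rfl⟩ := hd
  refine ⟨j + 1, ?_⟩
  have h5 := zeta_pow_five
  fin_cases j <;> simp <;> first | ring1 | linear_combination (s * u : ℂ) * h5

theorem hasSign_zeta_pow_mul_iff (m : ℕ) : HasSign u s (zeta ^ m * d) ↔ HasSign u s d := by
  have mul : ∀ (m : ℕ) (d : ℂ), HasSign u s d → HasSign u s (zeta ^ m * d) := by
    intro m d hd
    induction m with
    | zero => simpa using hd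
    | succ m ih => simpa [pow_succ', mul_assoc] using ih.zeta_mul
  refine ⟨fun h => ?_, mul m d⟩
  have h' := mul (4 * m) _ h
  rwa [← mul_assoc, ← pow_add, show 4 * m + m = 5 * m by ring, pow_mul, zeta_pow_five, one_pow,
    one_mul] at h'

theorem HasLevel.add (hz : HasLevel b u n z) (hd : HasSign u s d) :
    HasLevel b u (n + s) (z + d) := by
  obtain ⟨k, hk, hz⟩ := hz
  obtain ⟨j, hj⟩ := hd.exists_step hz
  exact ⟨_, by simp [Finset.sum_add_distrib, hk], hj⟩

theorem HasSign.hasLevel_add_iff (hd : HasSign u s d) :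
    HasLevel b u (n + s) (z + d) ↔ HasLevel b u n z :=
  ⟨fun h => by simpa using h.add hd.neg, fun h => h.add hd⟩

namespace Tile

/-- `side'` is the rotation of `side` by this number of fifths of a full turn. -/
def turn (S : Tile) : ℕ :=
  match S.kind with
  | .fat => 1
  | .thin => 2

theorem side'_eq (S : Tile) : S.side' = zeta ^ S.turn * S.side := by
  cases h : S.kind
  · simp only [side', turn, h, pow_one, zeta]
  · simp only [side', turn, h, zeta_sq]

theorem hasSign_side'_iff (S : Tile) : HasSign u s S.side' ↔ HasSign u s S.side := by
  rw [S.side'_eq, hasSign_zeta_pow_mul_iff]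

/-- The placement of a tile in the lattice: the level `σ.1` of its apex and the common sign `σ.2`
of the two sides issuing from the apex. -/
def HasState (b u : ℂ) (σ : ℤ × ℤ) (S : Tile) : Prop :=
  HasLevel b u σ.1 S.apex ∧ HasSign u σ.2 S.side

end Tile

/-- The change of state across a solid edge between a fat and a thin tile. -/
def flip (σ : ℤ × ℤ) : ℤ × ℤ := (σ.1 + 3 * σ.2, -σ.2)

theorem flip_flip (σ : ℤ × ℤ) : flip (flip σ) = σ := by
  ext <;> simp [flip]

/-- An arrow lies in the lattice as the arrows of a fat tile of state `σ` do. -/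
def Arrow.HasState (b u : ℂ) (σ : ℤ × ℤ) (e : Arrow) : Prop :=
  match e.kind with
  | .dashed => HasLevel b u σ.1 e.target ∧ HasSign u σ.2 (e.source - e.target)
  | .solid => HasLevel b u (σ.1 + 2 * σ.2) e.source ∧ HasSign u (-σ.2) (e.target - e.source)

namespace Tile

/-- The tile has state `σ` or `flip σ`. The matching rules make this pass to tiles that share an
edge. -/
def IsGood (b u : ℂ) (σ : ℤ × ℤ) (S : Tile) : Prop := S.HasState b u σ ∨ S.HasState b u (flip σ)

theorem hasState_iff_dashed (S : Tile) (σ : ℤ × ℤ) {d : ℂ}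
    (hd : HasSign u σ.2 d ↔ HasSign u σ.2 S.side) :
    S.HasState b u σ ↔ Arrow.HasState b u σ ⟨.dashed, S.apex + d, S.apex⟩ := by
  simp [HasState, Arrow.HasState, hd]

theorem hasState_iff_solid_out (S : Tile) (σ : ℤ × ℤ) {d d' : ℂ}
    (hd : HasSign u σ.2 d ↔ HasSign u σ.2 S.side)
    (hd' : HasSign u σ.2 d' ↔ HasSign u σ.2 S.side) :
    S.HasState b u σ ↔ Arrow.HasState b u σ ⟨.solid, S.apex + d + d', S.apex + d⟩ := by
  have e : S.apex + d - (S.apex + d + d') = -d' := by ring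
  simp only [HasState, Arrow.HasState, e, hasSign_neg_iff, hd']
  refine and_congr_left fun h => ?_
  rw [two_mul, ← add_assoc, (hd'.2 h).hasLevel_add_iff, (hd.2 h).hasLevel_add_iff]

theorem hasState_iff_solid_in (S : Tile) (σ : ℤ × ℤ) {d d' : ℂ}
    (hd : HasSign u σ.2 d ↔ HasSign u σ.2 S.side)
    (hd' : HasSign u σ.2 d' ↔ HasSign u σ.2 S.side) :
    S.HasState b u σ ↔
      Arrow.HasState b u (flip σ) ⟨.solid, S.apex + d, S.apex + d + d'⟩ := by
  have e : S.apex + d + d' - (S.apex + d) = d' := by ring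
  have e' : σ.1 + 3 * σ.2 + 2 * -σ.2 = σ.1 + σ.2 := by ring
  simp only [HasState, Arrow.HasState, flip, e, e', neg_neg, hd']
  refine and_congr_left fun h => ?_
  rw [(hd.2 h).hasLevel_add_iff]

theorem opposite_eq (S : Tile) : S.opposite = S.apex + S.side' + S.side := by
  rw [opposite]
  ring

/-- An arrow of a tile determines the state of the tile up to `flip`. -/
theorem isGood_iff_of_mem_arrows {S : Tile} {e : Arrow} (he : e ∈ S.arrows) (σ : ℤ × ℤ) :
    S.IsGood b u σ ↔ (e.HasState b u σ ∨ e.HasState b u (flip σ)) := by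
  have h1 : ∀ s, HasSign u s S.side ↔ HasSign u s S.side := fun s => Iff.rfl
  have h2 : ∀ s, HasSign u s S.side' ↔ HasSign u s S.side := fun s => S.hasSign_side'_iff
  unfold IsGood
  cases h : S.kind <;> simp only [arrows, h, Set.mem_insert_iff, Set.mem_singleton_iff] at he <;>
    rcases he with rfl | rfl | rfl | rfl
  · rw [S.hasState_iff_dashed _ (h1 _), S.hasState_iff_dashed _ (h1 _)]
  · rw [S.hasState_iff_dashed _ (h2 _), S.hasState_iff_dashed _ (h2 _)]
  · rw [opposite, S.hasState_iff_solid_out _ (h1 _) (h2 _),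
      S.hasState_iff_solid_out _ (h1 _) (h2 _)]
  · rw [opposite_eq, S.hasState_iff_solid_out _ (h2 _) (h1 _),
      S.hasState_iff_solid_out _ (h2 _) (h1 _)]
  · rw [S.hasState_iff_dashed _ (h1 _), S.hasState_iff_dashed _ (h1 _)]
  · rw [S.hasState_iff_dashed _ (h2 _), S.hasState_iff_dashed _ (h2 _)]
  · rw [opposite, S.hasState_iff_solid_in _ (h1 _) (h2 _),
      S.hasState_iff_solid_in _ (h1 _) (h2 _), flip_flip, or_comm]
  · rw [opposite_eq, S.hasState_iff_solid_in _ (h2 _) (h1 _),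
      S.hasState_iff_solid_in _ (h2 _) (h1 _), flip_flip, or_comm]

/-- With the apex of one tile at level `0`, the corners of the tiles have levels in `{0, 1, 2, 3}`,
so that the residue class `4` modulo `5` is never met. -/
theorem IsGood.exists_coords {S : Tile} (hS : S.IsGood b u (0, 1)) {p : ℂ} (hp : p ∈ S.corners) :
    ∃ k : Fin 5 → ℤ, ∑ j, k j ∈ Set.Icc (0 : ℤ) 3 ∧ p = b + u * intSum k := by
  suffices h : ∃ n ∈ Set.Icc (0 : ℤ) 3, HasLevel b u n p by
    obtain ⟨n, hn, k, rfl, hk⟩ := h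
    exact ⟨k, hn, hk⟩
  simp only [corners, Set.mem_insert_iff, Set.mem_singleton_iff] at hp
  rcases hS with ⟨h1, h2⟩ | ⟨h1, h2⟩ <;> simp only [flip] at h1 h2 <;>
    have h3 := S.hasSign_side'_iff.2 h2 <;> rcases hp with rfl | rfl | rfl | rfl
  · exact ⟨_, by simp, h1⟩
  · exact ⟨_, by simp, h1.add h2⟩
  · exact ⟨_, by simp, (h1.add h2).add h3⟩
  · exact ⟨_, by simp, h1.add h3⟩
  · exact ⟨_, by simp, h1⟩
  · exact ⟨_, by simp, h1.add h2⟩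
  · exact ⟨_, by simp, (h1.add h2).add h3⟩
  · exact ⟨_, by simp, h1.add h3⟩

theorem IsGood.exists_hasSign {S : Tile} (hS : S.IsGood b u (0, 1)) {e : Arrow}
    (he : e ∈ S.arrows) : HasSign u 1 (e.target - e.source) ∨ HasSign u 1 (e.source - e.target) := by
  have key : ∀ {s : ℤ} {d : ℂ}, s = 1 ∨ s = -1 → HasSign u s d →
      HasSign u 1 d ∨ HasSign u 1 (-d) := by
    rintro s d (rfl | rfl) h
    · exact Or.inl h
    · exact Or.inr (by simpa using h.neg)
  cases hk : e.kind <;> rcases (isGood_iff_of_mem_arrows he _).1 hS with h | h <;>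
    simp only [Arrow.HasState, hk, flip] at h
  · exact (by simpa using key (by simp) h.2 : _ ∨ _).symm
  · exact (by simpa using key (by simp) h.2 : _ ∨ _).symm
  · simpa using key (by simp) h.2
  · simpa using key (by simp) h.2

end Tile

/-! ### Local finiteness of tilings and connectedness through edges -/

namespace Tile

/-- The angle at the apex. -/
noncomputable def angle (S : Tile) : ℝ :=
  match S.kind with
  | .fat => 2 * Real.pi / 5
  | .thin => 4 * Real.pi / 5

theorem side'_eq_exp (S : Tile) : S.side' = Complex.exp (S.angle * Complex.I) * S.side := by
  cases h : S.kind <;> simp only [side', angle, h]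

theorem half_le_sin_angle (S : Tile) : 1 / 2 ≤ Real.sin S.angle := by
  have hpi := Real.pi_pos
  rw [← Real.sin_pi_div_six]
  cases h : S.kind <;> simp only [angle, h]
  · exact Real.sin_le_sin_of_le_of_le_pi_div_two (by linarith) (by linarith) (by linarith)
  · rw [← Real.sin_pi_sub (4 * Real.pi / 5)]
    exact Real.sin_le_sin_of_le_of_le_pi_div_two (by linarith) (by linarith) (by linarith)

theorem norm_side' (S : Tile) : ‖S.side'‖ = 1 := by
  rw [S.side'_eq_exp, norm_mul, Complex.norm_exp_ofReal_mul_I, S.norm_side, one_mul]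

theorem side_ne_zero (S : Tile) : S.side ≠ 0 := by
  intro h
  simpa [h] using S.norm_side

/-- The centre of symmetry of the rhombus. -/
noncomputable def center (S : Tile) : ℂ := S.apex + (S.side + S.side') / 2

theorem ball_center_subset_region (S : Tile) : Metric.ball S.center (1 / 10) ⊆ S.region := by
  intro z hz
  rw [Metric.mem_ball, dist_eq_norm] at hz
  set w : ℂ := (z - S.center) / S.side with hw
  have hwn : ‖w‖ < 1 / 10 := by rwa [hw, norm_div, S.norm_side, div_one]
  have hre := (abs_le.1 ((Complex.abs_re_le_norm w).trans hwn.le))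
  have him := (abs_le.1 ((Complex.abs_im_le_norm w).trans hwn.le))
  have hsin := S.half_le_sin_angle
  -- `w = a + b * exp (angle * I)` with `a` and `b` real
  set b : ℝ := w.im / Real.sin S.angle with hb
  have hbs : b * Real.sin S.angle = w.im := div_mul_cancel₀ _ (by linarith)
  have hb1 : b ≤ 1 / 5 := by
    rw [hb, div_le_iff₀ (by linarith)]
    linarith
  have hb2 : -(1 / 5) ≤ b := by
    rw [hb, le_div_iff₀ (by linarith)]
    linarith
  have hbc := abs_le.1 (show |b * Real.cos S.angle| ≤ 1 / 5 by
    rw [abs_mul]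
    calc |b| * |Real.cos S.angle| ≤ 1 / 5 * 1 :=
          mul_le_mul (abs_le.2 ⟨hb2, hb1⟩) (Real.abs_cos_le_one _) (abs_nonneg _) (by norm_num)
      _ = 1 / 5 := mul_one _)
  set a : ℝ := w.re - b * Real.cos S.angle with ha
  have hwab : w = a + b * Complex.exp (S.angle * Complex.I) := by
    apply Complex.ext
    · rw [Complex.add_re, Complex.re_ofReal_mul, Complex.exp_ofReal_mul_I_re, Complex.ofReal_re, ha]
      ring
    · rw [Complex.add_im, Complex.im_ofReal_mul, Complex.exp_ofReal_mul_I_im, Complex.ofReal_im, hbs,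
        zero_add]
  refine ⟨1 / 2 + a, ⟨by linarith, by linarith⟩, 1 / 2 + b, ⟨by linarith, by linarith⟩, ?_⟩
  have hz' : z = S.center + w * S.side := by
    rw [hw, div_mul_cancel₀ _ S.side_ne_zero]
    ring
  rw [hz', hwab, center, S.side'_eq_exp]
  push_cast
  ring

theorem dist_center_le {S : Tile} {z : ℂ} (hz : z ∈ S.region) : dist z S.center ≤ 1 := by
  obtain ⟨a, ⟨ha0, ha1⟩, b, ⟨hb0, hb1⟩, rfl⟩ := hz
  have e : S.apex + a * S.side + b * S.side' - S.center
      = ((a - 1 / 2 : ℝ) : ℂ) * S.side + ((b - 1 / 2 : ℝ) : ℂ) * S.side' := by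
    rw [center]
    push_cast
    ring
  rw [dist_eq_norm, e]
  refine (norm_add_le _ _).trans ?_
  rw [norm_mul, norm_mul, S.norm_side, S.norm_side', Complex.norm_real, Complex.norm_real,
    mul_one, mul_one, Real.norm_eq_abs, Real.norm_eq_abs]
  have h1 : |a - 1 / 2| ≤ 1 / 2 := abs_le.2 ⟨by linarith, by linarith⟩
  have h2 : |b - 1 / 2| ≤ 1 / 2 := abs_le.2 ⟨by linarith, by linarith⟩
  linarith

theorem isClosed_region (S : Tile) : IsClosed S.region := by
  have e : S.region = (fun p : ℝ × ℝ => S.apex + (p.1 : ℂ) * S.side + (p.2 : ℂ) * S.side') ''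
      (Set.Icc 0 1 ×ˢ Set.Icc 0 1) := by
    ext z
    constructor
    · rintro ⟨a, ha, b, hb, rfl⟩
      exact ⟨(a, b), ⟨ha, hb⟩, rfl⟩
    · rintro ⟨⟨a, b⟩, ⟨ha, hb⟩, rfl⟩
      exact ⟨a, ha, b, hb, rfl⟩
  rw [e]
  exact ((isCompact_Icc.prod isCompact_Icc).image (by fun_prop)).isClosed

theorem apex_mem_region (S : Tile) : S.apex ∈ S.region :=
  ⟨0, by simp, 0, by simp, by simp⟩

theorem finite_corners (S : Tile) : S.corners.Finite := by
  simp [corners]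

end Tile

theorem not_ball_subset_line {x p d : ℂ} {r : ℝ} (hr : 0 < r) :
    ¬ Metric.ball x r ⊆ {z | ∃ t : ℝ, z = p + t * d} := by
  intro h
  have hn : ‖(r / 2 : ℂ)‖ < r := by
    rw [show (r / 2 : ℂ) = ((r / 2 : ℝ) : ℂ) by push_cast; rfl, Complex.norm_real,
      Real.norm_eq_abs, abs_of_pos (by linarith)]
    linarith
  obtain ⟨t0, h0⟩ := h (Metric.mem_ball_self hr)
  obtain ⟨t1, h1⟩ := h (show x + r / 2 ∈ Metric.ball x r by
    simpa [Metric.mem_ball, dist_eq_norm] using hn)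
  obtain ⟨t2, h2⟩ := h (show x + r / 2 * Complex.I ∈ Metric.ball x r by
    simpa [Metric.mem_ball, dist_eq_norm] using hn)
  have e1 : (r / 2 : ℂ) = ((t1 - t0 : ℝ) : ℂ) * d := by
    push_cast
    linear_combination h1 - h0
  have e2 : (r / 2 : ℂ) * Complex.I = ((t2 - t0 : ℝ) : ℂ) * d := by
    push_cast
    linear_combination h2 - h0
  have i1 := congrArg Complex.im e1
  have r1 := congrArg Complex.re e1
  have r2 := congrArg Complex.re e2
  have i2 := congrArg Complex.im e2
  have er : (r / 2 : ℂ) = ((r / 2 : ℝ) : ℂ) := by push_cast; rfl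
  rw [er] at i1 r1 r2 i2
  simp only [Complex.mul_re, Complex.mul_im, Complex.ofReal_re, Complex.ofReal_im, Complex.I_re,
    Complex.I_im] at i1 r1 r2 i2
  have d1 : d.im = 0 := by
    have : (t1 - t0) * d.im = 0 := by linarith
    rcases mul_eq_zero.1 this with h | h
    · rw [h] at r1
      nlinarith
    · exact h
  rw [d1] at i2
  nlinarith

namespace IsPenroseTiling

variable {T : Set Tile}

theorem disjoint_ball_center (hT : IsPenroseTiling T) {S S' : Tile} (hS : S ∈ T) (hS' : S' ∈ T)
    (hne : S ≠ S') :
    Disjoint (Metric.ball S.center (1 / 10)) (Metric.ball S'.center (1 / 10)) := by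
  rw [Set.disjoint_iff_inter_eq_empty]
  by_contra hcon
  obtain ⟨x, hx⟩ := Set.nonempty_iff_ne_empty.2 hcon
  obtain ⟨r, hr, hsub⟩ := Metric.isOpen_iff.1 (Metric.isOpen_ball.inter Metric.isOpen_ball) x hx
  have hsub' : Metric.ball x r ⊆ S.region ∩ S'.region := fun z hz =>
    ⟨S.ball_center_subset_region (hsub hz).1, S'.ball_center_subset_region (hsub hz).2⟩
  rcases hT.matching S hS S' hS' hne with h | ⟨p, -, h⟩ | ⟨e, -, h⟩
  · rw [h] at hsub'
    exact hsub' (Metric.mem_ball_self hr)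
  · refine not_ball_subset_line (p := p) (d := 0) hr (hsub'.trans ?_)
    rw [h]
    rintro z rfl
    exact ⟨0, by simp⟩
  · refine not_ball_subset_line (p := e.source) (d := e.target - e.source) hr (hsub'.trans ?_)
    rw [h, segment_eq_image']
    rintro z ⟨t, -, rfl⟩
    exact ⟨t, by simp⟩

theorem finite_center_mem_ball (hT : IsPenroseTiling T) (z : ℂ) (R : ℝ) :
    {S : Tile | S ∈ T ∧ S.center ∈ Metric.ball z R}.Finite := by
  set A := {S : Tile | S ∈ T ∧ S.center ∈ Metric.ball z R} with hA
  -- the disjoint balls around the centres have equal positive areas and fill a bounded set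
  have hpos : 0 < MeasureTheory.volume (Metric.ball (0 : ℂ) (1 / 10)) :=
    Metric.measure_ball_pos _ _ (by norm_num)
  have hfin := MeasureTheory.Measure.finite_const_le_meas_of_disjoint_iUnion
    (MeasureTheory.volume : MeasureTheory.Measure ℂ) hpos
    (As := fun S : A => Metric.ball (S : Tile).center (1 / 10))
    (fun S => measurableSet_ball)
    (fun S S' hne => hT.disjoint_ball_center S.2.1 S'.2.1 fun h => hne (Subtype.ext h)) (by
      refine ne_top_of_le_ne_top
        (Metric.isBounded_ball (x := z) (r := R + 1 / 10)).measure_lt_top.ne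
        (MeasureTheory.measure_mono (Set.iUnion_subset fun S x hx => ?_))
      have h1 := S.2.2
      rw [Metric.mem_ball] at h1 hx ⊢
      linarith [dist_triangle x (S : Tile).center z])
  have huniv : {S : A | MeasureTheory.volume (Metric.ball (0 : ℂ) (1 / 10)) ≤
      MeasureTheory.volume (Metric.ball (S : Tile).center (1 / 10))} = Set.univ := by
    ext S
    simp [MeasureTheory.Measure.addHaar_ball_center]
  rw [huniv] at hfin
  exact Set.finite_coe_iff.1 (Set.finite_univ_iff.1 hfin)

theorem isClosed_biUnion_region (hT : IsPenroseTiling T) {A : Set Tile} (hA : A ⊆ T) :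
    IsClosed (⋃ S : A, (S : Tile).region) := by
  refine LocallyFinite.isClosed_iUnion (fun z => ⟨Metric.ball z 1, Metric.ball_mem_nhds z one_pos,
    ?_⟩) fun S => (S : Tile).isClosed_region
  refine Set.Finite.of_finite_image ((hT.finite_center_mem_ball z 2).subset ?_)
    Subtype.val_injective.injOn
  rintro _ ⟨S, ⟨x, hx, hxz⟩, rfl⟩
  refine ⟨hA S.2, ?_⟩
  have := Tile.dist_center_le hx
  rw [Metric.mem_ball] at hxz ⊢
  linarith [dist_triangle_left (S : Tile).center z x]

theorem countable (hT : IsPenroseTiling T) : T.Countable := by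
  refine (Set.countable_iUnion fun n : ℕ =>
    (hT.finite_center_mem_ball 0 n).countable).mono fun S hS => ?_
  obtain ⟨n, hn⟩ := exists_nat_gt ‖S.center‖
  exact Set.mem_iUnion.2 ⟨n, hS, by simpa using hn⟩

/-- A tiling is connected through common edges: a property that passes from tile to tile along
common arrows holds for all tiles as soon as it holds for one. The tiles that have it and those
that lack it cover two closed sets, which meet in corners only; removing the countably many
corners leaves the plane connected. -/
theorem forall_of_propagates (hT : IsPenroseTiling T) {P : Tile → Prop}
    (hP : ∀ S ∈ T, ∀ S' ∈ T, ∀ e ∈ S.arrows ∩ S'.arrows, P S → P S')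
    {S₀ : Tile} (hS₀ : S₀ ∈ T) (h₀ : P S₀) : ∀ S ∈ T, P S := by
  intro S₁ hS₁
  by_contra h₁
  set C : Set ℂ := ⋃ S ∈ T, S.corners with hC
  have hcount : C.Countable := hT.countable.biUnion fun S _ => S.finite_corners.countable
  have hconn : IsPreconnected Cᶜ :=
    (hcount.isPathConnected_compl_of_one_lt_rank
      (by rw [Complex.rank_real_complex]; norm_num)).isConnected.isPreconnected
  have inter : ∀ S : Tile, (Cᶜ ∩ S.region).Nonempty := by
    intro S
    by_contra hemp
    have hsub : Metric.ball S.center (1 / 10) ⊆ C := fun z hz => by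
      by_contra hz'
      exact hemp ⟨z, hz', S.ball_center_subset_region hz⟩
    have hd := hcount.dense_compl ℝ
    obtain ⟨z, hz, hz'⟩ := hd.inter_open_nonempty _ Metric.isOpen_ball
      ⟨S.center, Metric.mem_ball_self (by norm_num : (0 : ℝ) < 1 / 10)⟩
    exact hz' (hsub hz)
  have hcl := fun A (hA : A ⊆ T) => hT.isClosed_biUnion_region hA
  obtain ⟨z, hzC, hz1, hz2⟩ := isPreconnected_closed_iff.1 hconn _ _
    (hcl {S | S ∈ T ∧ P S} fun S h => h.1) (hcl {S | S ∈ T ∧ ¬ P S} fun S h => h.1)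
    (by
      intro z _
      obtain ⟨S, hS, hz⟩ := hT.covers z
      by_cases h : P S
      · exact Or.inl (Set.mem_iUnion.2 ⟨⟨S, hS, h⟩, hz⟩)
      · exact Or.inr (Set.mem_iUnion.2 ⟨⟨S, hS, h⟩, hz⟩))
    (by
      obtain ⟨z, hz, hz'⟩ := inter S₀
      exact ⟨z, hz, Set.mem_iUnion.2 ⟨⟨S₀, hS₀, h₀⟩, hz'⟩⟩)
    (by
      obtain ⟨z, hz, hz'⟩ := inter S₁
      exact ⟨z, hz, Set.mem_iUnion.2 ⟨⟨S₁, hS₁, h₁⟩, hz'⟩⟩)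
  obtain ⟨⟨S, hS, hPS⟩, hzS⟩ := Set.mem_iUnion.1 hz1
  obtain ⟨⟨S', hS', hPS'⟩, hzS'⟩ := Set.mem_iUnion.1 hz2
  have hz : z ∈ S.region ∩ S'.region := ⟨hzS, hzS'⟩
  rcases hT.matching S hS S' hS' (fun h => hPS' (h ▸ hPS)) with h | ⟨p, hp, h⟩ | ⟨e, he, -⟩
  · rw [h] at hz
    exact hz
  · rw [h] at hz
    rw [Set.mem_singleton_iff.1 hz] at hzC
    exact hzC (Set.mem_biUnion hS hp.1)
  · exact hPS' (hP S hS S' hS' e he hPS)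

end IsPenroseTiling

/-! ### Coordinates centred at the centre of rotation -/

theorem rotateCW_succ (c z : ℂ) (j : ℕ) :
    zeta * (rotateCW c (2 * Real.pi * (j + 1 : ℕ) / 5) z - c)
      = rotateCW c (2 * Real.pi * j / 5) z - c := by
  simp only [rotateCW, add_sub_cancel_left, zeta]
  rw [← mul_assoc, ← Complex.exp_add]
  congr 2
  push_cast
  ring

/-- Five-fold symmetry is a condition on the generator alone. -/
theorem isSymmetricRealization_iff {V : Type*} {G : SimpleGraph V}
    (θ : Multiplicative (ZMod 5) →* (G ≃g G)) (c : ℂ) (ρ : V → ℂ) :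
    IsSymmetricRealization 5 θ c ρ ↔
      ∀ v, zeta * (ρ (θ (Multiplicative.ofAdd 1) v) - c) = ρ v - c := by
  constructor
  · intro h v
    have h1 := h 1 v
    have h2 := rotateCW_succ c (ρ v) 0
    simp only [Nat.cast_one, Nat.cast_ofNat, zero_add] at h1 h2
    rw [h1, h2]
    simp [rotateCW]
  · intro h j v
    induction j with
    | zero => simp [rotateCW]
    | succ j ih =>
      have e : θ (Multiplicative.ofAdd ((j + 1 : ℕ) : ZMod 5)) v
          = θ (Multiplicative.ofAdd 1) (θ (Multiplicative.ofAdd (j : ZMod 5)) v) := by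
        rw [← RelIso.mul_apply, ← map_mul, ← ofAdd_add, Nat.cast_succ, add_comm]
      have h1 := h (θ (Multiplicative.ofAdd (j : ZMod 5)) v)
      have h2 := rotateCW_succ c (ρ v) j
      simp only [Nat.cast_ofNat] at ih ⊢
      rw [← e, ih, ← h2] at h1
      exact sub_left_injective (mul_left_cancel₀ zeta_ne_zero h1)

/-- If a five-fold rotation permutes lattice points whose levels avoid a residue class modulo `5`,
then its centre is a lattice point, and in coordinates relative to the centre the rotation is the
cyclic shift. Modulo `5`, the rotation changes all levels by the same constant; were that not `0`,
a point and its first four images would meet every residue class. -/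
theorem exists_centered_coords {V : Type*} [Nonempty V] {g : V → V} {ρ : V → ℂ}
    {b c u : ℂ} (hu : u ≠ 0) {k : V → Fin 5 → ℤ}
    (hk : ∀ v, ∑ j, k v j ∈ Set.Icc (0 : ℤ) 3) (hρk : ∀ v, ρ v = b + u * intSum (k v))
    (hρ : ∀ v, zeta * (ρ (g v) - c) = ρ v - c) :
    ∃ y : Fin 5 → ℤ, (∀ v, ρ v = c + u * intSum (k v - y)) ∧
      ∀ v j, (k (g v) - y) j = (k v - y) (j + 1) := by
  let x : V → Fin 5 → ℤ := fun v => k (g v) - fun j => k v (j + 1)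
  have hx : ∀ v, u * (zeta * intSum (x v)) = (zeta - 1) * (c - b) := by
    intro v
    have h1 := hρ v
    rw [hρk, hρk v] at h1
    simp only [x]
    rw [intSum_sub, mul_sub, intSum_shift]
    linear_combination h1
  have hsum : ∀ v, ∑ j, x v j = ∑ j, k (g v) j - ∑ j, k v j := by
    intro v
    simp only [x, Pi.sub_apply, Fin.sum_univ_five]
    simp only [show (0 + 1 : Fin 5) = 1 from rfl, show (1 + 1 : Fin 5) = 2 from rfl,
      show (2 + 1 : Fin 5) = 3 from rfl, show (3 + 1 : Fin 5) = 4 from rfl,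
      show (4 + 1 : Fin 5) = 0 from rfl]
    ring
  have hxx : ∀ v w, intSum (x v) = intSum (x w) := fun v w =>
    mul_left_cancel₀ zeta_ne_zero (mul_left_cancel₀ hu ((hx v).trans (hx w).symm))
  have hzero : ∀ v, ∑ j, x v j = 0 := by
    intro v
    obtain ⟨m1, h1, -⟩ := exists_eq_add_of_intSum_eq (hxx (g v) v)
    obtain ⟨m2, h2, -⟩ := exists_eq_add_of_intSum_eq (hxx (g (g v)) v)
    obtain ⟨m3, h3, -⟩ := exists_eq_add_of_intSum_eq (hxx (g (g (g v))) v)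
    rw [hsum, hsum] at h1 h2 h3
    rw [hsum]
    obtain ⟨a0, a0'⟩ := hk v
    obtain ⟨a1, a1'⟩ := hk (g v)
    obtain ⟨a2, a2'⟩ := hk (g (g v))
    obtain ⟨a3, a3'⟩ := hk (g (g (g v)))
    obtain ⟨a4, a4'⟩ := hk (g (g (g (g v))))
    generalize ∑ j, k v j = s0 at *
    generalize ∑ j, k (g v) j = s1 at *
    generalize ∑ j, k (g (g v)) j = s2 at *
    generalize ∑ j, k (g (g (g v))) j = s3 at *
    generalize ∑ j, k (g (g (g (g v)))) j = s4 at *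
    obtain ⟨r, hr⟩ : ∃ r, r = s1 - s0 := ⟨_, rfl⟩
    have hr1 : -3 ≤ r := by omega
    have hr2 : r ≤ 3 := by omega
    rw [← hr]
    interval_cases r <;> omega
  obtain ⟨v₀⟩ := ‹Nonempty V›
  set q := x v₀ with hq
  have hconst : ∀ v, x v = q := fun v =>
    eq_of_intSum_eq (hxx v v₀) (by rw [hq, hzero, hzero]; norm_num)
  -- the solution of `y j - y (j + 1) = q j`, which exists as the `q j` sum to zero
  obtain ⟨y, hy⟩ : ∃ y : Fin 5 → ℤ, ∀ j, y j - y (j + 1) = q j := by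
    refine ⟨![0, -q 0, -q 0 - q 1, -q 0 - q 1 - q 2, -q 0 - q 1 - q 2 - q 3], fun j => ?_⟩
    have h0 := hzero v₀
    rw [← hq, Fin.sum_univ_five] at h0
    fin_cases j <;> simp
    linarith
  have hyc : u * intSum y = c - b := by
    have e : intSum q = intSum y - intSum fun j => y (j + 1) := by
      rw [← intSum_sub]
      congr 1
      ext j
      exact (hy j).symm
    have h1 := hx v₀
    rw [← hq, e, mul_sub, intSum_shift] at h1
    refine mul_left_cancel₀ (sub_ne_zero.2 (isPrimitiveRoot_zeta.ne_one (by norm_num))) ?_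
    linear_combination h1
  refine ⟨y, fun v => ?_, fun v j => ?_⟩
  · rw [intSum_sub, hρk]
    linear_combination hyc
  · have h1 := congrFun (hconst v) j
    have h2 := hy j
    simp only [x, Pi.sub_apply] at h1 ⊢
    linarith

/-! ### Folding the coordinates -/

/-- The point reached from `0` after `n` unit steps along the line (backwards for negative `n`),
where the steps at odd places are turned by the angle `t`. -/
noncomputable def foldCoord (t : ℝ) (n : ℤ) : ℂ :=
  ((n + 1) / 2 : ℤ) + (n / 2 : ℤ) * Complex.exp (t * Complex.I)

theorem foldCoord_zero (n : ℤ) : foldCoord 0 n = n := by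
  have h : (n + 1) / 2 + n / 2 = n := by omega
  simp only [foldCoord, Complex.ofReal_zero, zero_mul, Complex.exp_zero, mul_one]
  exact_mod_cast h

theorem norm_foldCoord_succ_sub (t : ℝ) (n : ℤ) :
    ‖foldCoord t (n + 1) - foldCoord t n‖ = 1 := by
  obtain ⟨m, rfl | rfl⟩ := Int.even_or_odd' n
  · have e : foldCoord t (2 * m + 1) - foldCoord t (2 * m) = 1 := by
      simp only [foldCoord, show (2 * m + 1 + 1) / 2 = m + 1 by omega,
        show (2 * m + 1) / 2 = m by omega, show 2 * m / 2 = m by omega]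
      push_cast
      ring
    rw [e, norm_one]
  · have e : foldCoord t (2 * m + 1 + 1) - foldCoord t (2 * m + 1)
        = Complex.exp (t * Complex.I) := by
      simp only [foldCoord, show (2 * m + 1 + 1 + 1) / 2 = m + 1 by omega,
        show (2 * m + 1 + 1) / 2 = m + 1 by omega, show (2 * m + 1) / 2 = m by omega]
      push_cast
      ring
    rw [e, Complex.norm_exp_ofReal_mul_I]

theorem norm_foldCoord_pi_le (n : ℤ) : ‖foldCoord Real.pi n‖ ≤ 1 := by
  rw [foldCoord, Complex.exp_pi_mul_I]
  obtain ⟨m, rfl | rfl⟩ := Int.even_or_odd' n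
  · rw [show (2 * m + 1) / 2 = m by omega, show 2 * m / 2 = m by omega]
    simp
  · rw [show (2 * m + 1 + 1) / 2 = m + 1 by omega, show (2 * m + 1) / 2 = m by omega]
    simp

theorem continuous_foldCoord (n : ℤ) : Continuous fun t => foldCoord t n := by
  unfold foldCoord
  fun_prop

/-- The folded placement of the point with coordinates `k` relative to `c`. -/
noncomputable def foldPoint (c u : ℂ) (t : ℝ) (k : Fin 5 → ℤ) : ℂ :=
  c + u * rootSum fun j => foldCoord t (k j)

theorem foldPoint_zero (c u : ℂ) (k : Fin 5 → ℤ) : foldPoint c u 0 k = c + u * intSum k := by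
  simp only [foldPoint, foldCoord_zero, intSum]

theorem continuous_foldPoint (c u : ℂ) (k : Fin 5 → ℤ) :
    Continuous fun t => foldPoint c u t k := by
  have := fun j => continuous_foldCoord (k j)
  unfold foldPoint rootSum
  fun_prop

theorem dist_foldPoint_add_single {c u : ℂ} (hu : ‖u‖ = 1) (t : ℝ) (k : Fin 5 → ℤ) (j : Fin 5) :
    dist (foldPoint c u t (k + Pi.single j 1)) (foldPoint c u t k) = 1 := by
  have e : foldPoint c u t (k + Pi.single j 1) - foldPoint c u t k
      = u * ((foldCoord t (k j + 1) - foldCoord t (k j)) * zeta ^ (j : ℕ)) := by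
    rw [← rootSum_single, foldPoint, foldPoint, add_sub_add_left_eq_sub, ← mul_sub, ← rootSum_sub]
    congr 2
    ext i
    by_cases h : i = j
    · subst h
      simp
    · simp [h]
  rw [dist_eq_norm, e, norm_mul, norm_mul, norm_pow, norm_zeta, norm_foldCoord_succ_sub, hu]
  norm_num

theorem dist_foldPoint_pi_le {c u : ℂ} (hu : ‖u‖ = 1) (k : Fin 5 → ℤ) :
    dist (foldPoint c u Real.pi k) c ≤ 5 := by
  rw [dist_eq_norm, foldPoint, add_sub_cancel_left, norm_mul, hu, one_mul, rootSum]
  refine (norm_sum_le _ _).trans ?_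
  refine (Finset.sum_le_card_nsmul _ _ 1 fun j _ => ?_).trans (by simp)
  rw [norm_mul, norm_pow, norm_zeta, one_pow, mul_one]
  exact norm_foldCoord_pi_le _

theorem zeta_mul_foldPoint_sub {c u : ℂ} {t : ℝ} {k l : Fin 5 → ℤ} (h : ∀ j, l j = k (j + 1)) :
    zeta * (foldPoint c u t l - c) = foldPoint c u t k - c := by
  rw [foldPoint, foldPoint, add_sub_cancel_left, add_sub_cancel_left,
    ← rootSum_shift fun j => foldCoord t (k j)]
  simp only [h]
  ring

/-! ### Frameworks of tilings -/

/-- The vertices of a five-fold symmetric Penrose framework have integer coordinates relative to the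
centre, in which every edge is a unit step in one coordinate and the rotation is the cyclic
shift. -/
theorem exists_foldable_coords {V : Type*} {G : SimpleGraph V} {ρ : V → ℂ}
    (hP : IsPenroseFramework G ρ) {θ : Multiplicative (ZMod 5) →* (G ≃g G)} {c : ℂ}
    (hρ : IsSymmetricRealization 5 θ c ρ) :
    ∃ (u : ℂ) (K : V → Fin 5 → ℤ), ‖u‖ = 1 ∧ (∀ v, ρ v = c + u * intSum (K v)) ∧
      (∀ v j, K (θ (Multiplicative.ofAdd 1) v) j = K v (j + 1)) ∧
      ∀ v w, G.Adj v w → ∃ j, K w = K v + Pi.single j 1 ∨ K v = K w + Pi.single j 1 := by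
  obtain ⟨T, hT, hinj, hrange, hadj⟩ := hP
  obtain ⟨S₀, hS₀, -⟩ := hT.covers 0
  set b := S₀.apex
  set u := S₀.side with hu
  have hgood : ∀ S ∈ T, S.IsGood b u (0, 1) := by
    refine hT.forall_of_propagates (fun S _ S' _ e he hS => ?_) hS₀ (Or.inl ⟨⟨0, ?_⟩, 0, ?_⟩)
    · rw [Tile.isGood_iff_of_mem_arrows he.1] at hS
      rwa [Tile.isGood_iff_of_mem_arrows he.2]
    · simp [intSum, rootSum, b]
    · simp [u]
  have hcoord : ∀ v, ∃ k : Fin 5 → ℤ, ∑ j, k j ∈ Set.Icc (0 : ℤ) 3 ∧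
      ρ v = b + u * intSum k := by
    intro v
    have hv : ρ v ∈ {p | ∃ S ∈ T, p ∈ S.corners} := hrange ▸ Set.mem_range_self v
    obtain ⟨S, hS, hv⟩ := hv
    exact (hgood S hS).exists_coords hv
  choose k hk hρk using hcoord
  have : Nonempty V := by
    have h : b ∈ Set.range ρ := hrange ▸ ⟨S₀, hS₀, by simp [Tile.corners, b]⟩
    exact ⟨h.choose⟩
  obtain ⟨y, hy, hshift⟩ := exists_centered_coords S₀.side_ne_zero hk hρk
    ((isSymmetricRealization_iff θ c ρ).1 hρ)
  refine ⟨u, fun v => k v - y, S₀.norm_side, hy, hshift, ?_⟩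
  have key : ∀ v w, HasSign u 1 (ρ w - ρ v) → ∃ j, k w - y = k v - y + Pi.single j 1 := by
    intro v w h
    obtain ⟨j, hj⟩ := h.exists_step (hρk v)
    rw [add_sub_cancel, hρk w] at hj
    refine ⟨j, ?_⟩
    rw [eq_of_intSum_eq (mul_left_cancel₀ S₀.side_ne_zero (add_left_cancel hj))]
    · abel
    · have h1 := hk v
      have h2 := hk w
      rw [Set.mem_Icc] at h1 h2
      simp only [Pi.add_apply, Finset.sum_add_distrib, Finset.sum_pi_single', Finset.mem_univ,
        if_true]
      rw [abs_lt]
      constructor <;> linarith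
  intro v w hvw
  obtain ⟨S, hS, e, he, h⟩ := (hadj v w).1 hvw
  have hor : HasSign u 1 (ρ w - ρ v) ∨ HasSign u 1 (ρ v - ρ w) := by
    have hs := (hgood S hS).exists_hasSign he
    rcases h with ⟨h1, h2⟩ | ⟨h1, h2⟩ <;> rw [h1, h2] at hs
    · exact hs
    · exact hs.symm
  rcases hor with h | h
  · obtain ⟨j, hj⟩ := key v w h
    exact ⟨j, Or.inl hj⟩
  · obtain ⟨j, hj⟩ := key w v h
    exact ⟨j, Or.inr hj⟩

theorem IsPenroseFramework.exists_lt_dist {V : Type*} {G : SimpleGraph V} {ρ : V → ℂ}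
    (hP : IsPenroseFramework G ρ) (R : ℝ) : ∃ v w, R < dist (ρ v) (ρ w) := by
  obtain ⟨T, hT, -, hrange, -⟩ := hP
  have near : ∀ z : ℂ, ∃ v, dist z (ρ v) ≤ 2 := by
    intro z
    obtain ⟨S, hS, hz⟩ := hT.covers z
    have h : S.apex ∈ Set.range ρ := hrange ▸ ⟨S, hS, by simp [Tile.corners]⟩
    obtain ⟨v, hv⟩ := h
    refine ⟨v, ?_⟩
    rw [hv]
    have h1 := Tile.dist_center_le hz
    have h2 := Tile.dist_center_le S.apex_mem_region
    linarith [dist_triangle_right z S.apex S.center]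
  obtain ⟨v, hv⟩ := near 0
  obtain ⟨w, hw⟩ := near ((|R| + 5 : ℝ) : ℂ)
  refine ⟨v, w, ?_⟩
  have h0 : dist (0 : ℂ) ((|R| + 5 : ℝ) : ℂ) = |R| + 5 := by
    rw [dist_comm, dist_zero_right, Complex.norm_real, Real.norm_eq_abs, abs_of_pos (by positivity)]
  have h1 := dist_triangle (0 : ℂ) (ρ v) ((|R| + 5 : ℝ) : ℂ)
  have h2 := dist_triangle (ρ v) (ρ w) ((|R| + 5 : ℝ) : ℂ)
  rw [dist_comm] at hw
  linarith [le_abs_self R]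

end Penrose

theorem corollary1p3 {V : Type*} (G : SimpleGraph V) (ρ : V → ℂ)
    (hP : Penrose.IsPenroseFramework G ρ)
    (θ : Multiplicative (ZMod 5) →* (G ≃g G)) (c : ℂ)
    (hG : Penrose.IsSymmetricGraph 5 G θ)
    (hρ : Penrose.IsSymmetricRealization 5 θ c ρ) :
    ∃ (δ : ℝ) (ρt : ℝ → V → ℂ),
      Penrose.IsFlex G ρ δ ρt ∧
      ¬ Penrose.IsTrivialFlex ρ δ ρt ∧
      ∀ t ∈ Set.Ico 0 δ, Penrose.IsSymmetricRealization 5 θ c (ρt t) := by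
  obtain ⟨u, K, hu, hK, hshift, hadj⟩ := Penrose.exists_foldable_coords hP hρ
  let ρt : ℝ → V → ℂ := fun t v => Penrose.foldPoint c u t (K v)
  have hzero : ρt 0 = ρ := by
    ext v
    simp only [ρt, Penrose.foldPoint_zero, hK]
  have hdist : ∀ t v w, G.Adj v w → dist (ρt t v) (ρt t w) = 1 := by
    intro t v w h
    obtain ⟨j, h | h⟩ := hadj v w h
    · simp only [ρt, h]
      rw [dist_comm]
      exact Penrose.dist_foldPoint_add_single hu t _ j
    · simp only [ρt, h]
      exact Penrose.dist_foldPoint_add_single hu t _ j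
  refine ⟨4, ρt, ⟨by norm_num, ?_, ?_, hzero, ?_⟩, ?_, ?_⟩
  · exact (continuous_pi fun v => Penrose.continuous_foldPoint c u (K v)).continuousOn
  · intro t _ v w h he
    have h1 := hdist t v w h
    rw [he, dist_self] at h1
    exact zero_ne_one h1
  · intro t _ v w h
    rw [hdist t v w h, ← hzero, hdist 0 v w h]
  · -- at `t = π` all steps along one direction cancel in pairs, and the placement is bounded
    intro htriv
    obtain ⟨M, hM⟩ := htriv Real.pi ⟨Real.pi_pos.le, Real.pi_lt_four⟩
    obtain ⟨v, w, hvw⟩ := hP.exists_lt_dist 10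
    rw [← hM v, ← hM w, M.dist_eq] at hvw
    have h1 := Penrose.dist_foldPoint_pi_le (c := c) hu (K v)
    have h2 := Penrose.dist_foldPoint_pi_le (c := c) hu (K w)
    have h3 := dist_triangle_right (ρt Real.pi v) (ρt Real.pi w) c
    simp only [ρt] at h3 hvw
    linarith
  · intro t _
    exact (Penrose.isSymmetricRealization_iff θ c _).2 fun v =>
      Penrose.zeta_mul_foldPoint_sub (hshift v)
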